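/- Let $n\ge 2$, let $d_1,\dots,d_n\ge 1$ be integers with $D:=\max_i d_i\ge 2$, and let $\mathcal H_{(d)}$ be the complex vector space of systems $f=(f_1,\dots,f_n)$ of homogeneous polynomials $f_i\in\mathbb C[z_0,\dots,z_n]$ of degree $d_i$, so that $f:\mathbb C^{n+1}\to\mathbb C^n$. Endow $\mathcal H_{(d)}$ with the norm associated with the unitarily invariant inner product $$\langle f,g\rangle=\sum_{i=1}^n\sum_{|\alpha|=d_i}\frac{\alpha_0!\cdots\alpha_n!}{d_i!}\,f_{i,\alpha}\overline{g_{i,\alpha}},\qquad f_i=\sum_{|\alpha|=d_i}f_{i,\alpha}z^\alpha,\quad g_i=\sum_{|\alpha|=d_i}g_{i,\alpha}z^\alpha.$$ For nonzero $f\in\mathcal H_{(d)}$ and nonzero $x\in\mathbb C^{n+1}$ let $Df(x)|_{x^\perp}$ be the restriction of the derivative of $f$ at $x$ to the Hermitian orthogonal complement $x^\perp$ of $x$, and let $$\mu(f,x)=\|f\|\,\Big\|\big(Df(x)|_{x^\perp}\big)^{-1}\operatorname{diag}\big(\sqrt{d_i}\,\|x\|^{d_i-1}\big)\Big\|$$ (operator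 norm), with $\mu(f,x)=\infty$ if $\operatorname{rank} Df(x)|_{x^\perp}<n$. Let $d_R(x,y)=\arccos\frac{|\langle x,y\rangle|}{\|x\|\,\|y\|}\in[0,\pi/2]$ be the Riemannian distance in $\mathbb P_n(\mathbb C)$ between the lines through $x$ and $y$. Let $0<\varepsilon\le 1/4$, let $f,g\in\mathcal H_{(d)}$ be nonzero systems and $x,y\in\mathbb C^{n+1}$ nonzero vectors. Put $$u=\tfrac12 D^{3/2}\mu(f,x)\,d_R(x,y),\qquad v=D^{1/2}\mu(f,x)\,\Big\|\frac{f}{\|f\|}-\frac{g}{\|g\|}\Big\|.$$ If $\operatorname{rank} Df(x)|_{x^\perp}=n$, $u\le\varepsilon/5$ and $v\le\varepsilon/5$, then $\operatorname{rank} Dg(y)|_{y^\perp}=n$ and $$(1-\varepsilon)\,\mu(g,y)\le\mu(f,x)\le(1+\varepsilon)\,\mu(g,y).$$ -/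

import Mathlib

open scoped Nat ENNReal InnerProductSpace

noncomputable section

namespace PolySys

/-- Systems `f = (f_1, …, f_n)` of homogeneous complex polynomials in `z_0, …, z_n`, where `f_i` has
degree `d_i` (or is zero). This is a complex vector space. -/
abbrev HomSystem {n : ℕ} (d : Fin n → ℕ) : Type :=
  ∀ i : Fin n, MvPolynomial.homogeneousSubmodule (Fin (n + 1)) ℂ (d i)

/-- The unitarily invariant Hermitian product
`∑ i, ∑ |α| = d_i, (α_0! ⋯ α_n! / d_i!) f_{i,α} conj(g_{i,α})`. -/
def sysInner {n : ℕ} {d : Fin n → ℕ} (f g : HomSystem d) : ℂ :=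
  ∑ i, ∑ α ∈ (Finset.univ : Finset (Fin (n + 1))).finsuppAntidiag (d i),
    ((∏ j, ((α j)! : ℂ)) / ((d i)! : ℂ)) *
      ((f i : MvPolynomial (Fin (n + 1)) ℂ).coeff α *
        star ((g i : MvPolynomial (Fin (n + 1)) ℂ).coeff α))

/-- The norm associated with `sysInner`. -/
def sysNorm {n : ℕ} {d : Fin n → ℕ} (f : HomSystem d) : ℝ :=
  √(sysInner f f).re

/-- The normalized system `f / ‖f‖`. -/
def normalize {n : ℕ} {d : Fin n → ℕ} (f : HomSystem d) : HomSystem d :=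
  (((sysNorm f)⁻¹ : ℝ) : ℂ) • f

/-- The polynomial map `ℂ^{n+1} → ℂ^n` given by a system. -/
def toMap {n : ℕ} {d : Fin n → ℕ} (f : HomSystem d)
    (z : EuclideanSpace ℂ (Fin (n + 1))) : EuclideanSpace ℂ (Fin n) :=
  WithLp.toLp 2 fun i =>
    MvPolynomial.eval (fun j => z j) (f i : MvPolynomial (Fin (n + 1)) ℂ)

/-- The restriction of the derivative `Df(x)` to `x^⊥` (Hermitian orthogonal complement). -/
def derivPerp {n : ℕ} {d : Fin n → ℕ} (f : HomSystem d) (x : EuclideanSpace ℂ (Fin (n + 1))) :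
    (ℂ ∙ x)ᗮ →L[ℂ] EuclideanSpace ℂ (Fin n) :=
  (fderiv ℂ (toMap f) x).comp (ℂ ∙ x)ᗮ.subtypeL

/-- The rank of `Df(x)|_{x^⊥}`. -/
def rankPerp {n : ℕ} {d : Fin n → ℕ} (f : HomSystem d) (x : EuclideanSpace ℂ (Fin (n + 1))) : ℕ :=
  Module.finrank ℂ (LinearMap.range (derivPerp f x).toLinearMap)

/-- The operator `diag (√d_i ‖x‖^{d_i - 1})` on `ℂ^n`. -/
def diagOp {n : ℕ} (d : Fin n → ℕ) (x : EuclideanSpace ℂ (Fin (n + 1))) :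
    EuclideanSpace ℂ (Fin n) →L[ℂ] EuclideanSpace ℂ (Fin n) :=
  Matrix.toEuclideanCLM (n := Fin n) (𝕜 := ℂ)
    (Matrix.diagonal fun i => ((√(d i : ℝ) * ‖x‖ ^ (d i - 1) : ℝ) : ℂ))

open scoped Classical in
/-- The condition number `μ(f, x) = ‖f‖ ‖(Df(x)|_{x^⊥})⁻¹ diag (√d_i ‖x‖^{d_i - 1})‖` (operator
norm), equal to `∞` when `Df(x)|_{x^⊥}` has rank less than `n`. For `x ≠ 0` the space `x^⊥` has
dimension `n`, so rank `n` means that `Df(x)|_{x^⊥}` is invertible. -/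
def condNumber {n : ℕ} {d : Fin n → ℕ} (f : HomSystem d) (x : EuclideanSpace ℂ (Fin (n + 1))) :
    ℝ≥0∞ :=
  if rankPerp f x = n then
    ENNReal.ofReal (sysNorm f * ‖(derivPerp f x).inverse.comp (diagOp d x)‖)
  else ⊤

/-- The Riemannian (Fubini–Study) distance in `ℙ_n(ℂ)` between the lines through the nonzero vectors
`x` and `y`, that is the angle in `[0, π/2]` between these lines. -/
def distR {n : ℕ} (x y : EuclideanSpace ℂ (Fin (n + 1))) : ℝ :=
  Real.arccos (‖⟪x, y⟫_ℂ‖ / (‖x‖ * ‖y‖))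

/-- `D = max d_i`. -/
def maxDeg {n : ℕ} (d : Fin n → ℕ) : ℕ := Finset.univ.sup d

/-- `u = D^{3/2} μ(f,x) d_R(x,y) / 2`. -/
def uParam {n : ℕ} {d : Fin n → ℕ} (f : HomSystem d) (x y : EuclideanSpace ℂ (Fin (n + 1))) :
    ℝ≥0∞ :=
  ENNReal.ofReal ((maxDeg d : ℝ) ^ (3 / 2 : ℝ)) * condNumber f x * ENNReal.ofReal (distR x y) / 2

/-- `v = D^{1/2} μ(f,x) ‖f/‖f‖ - g/‖g‖‖`. -/
def vParam {n : ℕ} {d : Fin n → ℕ} (f g : HomSystem d) (x : EuclideanSpace ℂ (Fin (n + 1))) :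
    ℝ≥0∞ :=
  ENNReal.ofReal ((maxDeg d : ℝ) ^ (1 / 2 : ℝ)) * condNumber f x *
    ENNReal.ofReal (sysNorm (normalize f - normalize g))

end PolySys

end

/-!
The idea is that `1 / μ` is Lipschitz. Write `A(f, x) w = diag (√d_i ‖x‖^{d_i - 1})⁻¹ Df(x) w`
(`scaledDeriv`). For `‖f‖ = 1` the condition number `μ(f, x)` is the least `m` with
`‖w‖ ≤ m ‖A(f, x) w‖` for all `w ⊥ x` (`exists_condNumber_eq`), so that `1 / μ(f, x)` is the least
singular value of `A(f, x)` on `x^⊥`. Everything being invariant under rescaling, one may take `x`,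
`y` to be unit vectors with `⟪x, y⟫ = cos θ`, `θ = d_R(x, y)`. Then `x^⊥` is carried isometrically
onto `y^⊥` by the reflection `V` in the complement of `x + y` (`transport`), and it suffices to
compare `A(f, x) w` with `A(g, y) (V w)`.

The unitarily invariant product has the reproducing kernel `⟪y, x⟫ ^ d`, which is the multinomial
theorem. Differentiating it once in each argument gives all inner products between the polynomials
representing the functionals `h ↦ Dh(x) w`
(`sum_weight_mul_monomialDeriv_mul_monomialDeriv`). Hence such a representer has norm `√d ‖w‖` when
`‖x‖ = 1` and `w ⊥ x`, and passing from `(x, w)` to `(y, V w)` moves it by at most `√d (d θ) ‖w‖`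
(`sum_weight_mul_norm_sub_transport_sq_le`). By the Cauchy–Schwarz inequality
`‖A(f, x) w - A(g, y) (V w)‖ ≤ η ‖w‖` with `η = ‖f - g‖ + D θ` for normalized `f`, `g`
(`norm_scaledDeriv_sub_scaledDeriv_transport_le`), and so `|1 / μ(f, x) - 1 / μ(g, y)| ≤ η`. The
hypotheses on `u` and `v`, together with `D ≥ 2`, give `μ(f, x) η ≤ ε / 2`.
-/

open scoped Nat ENNReal InnerProductSpace

noncomputable section

namespace PolySys

/-! ### The reproducing kernel of the unitarily invariant product -/

section Kernel

variable {ι : Type*} [Fintype ι]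

/-- The derivative of the monomial `z ^ α` at the point `p` in the direction `a`. -/
def monomialDeriv (α : ι →₀ ℕ) (p a : ι → ℂ) : ℂ :=
  deriv (fun t : ℂ => ∏ j, (p j + t * a j) ^ α j) 0

theorem hasDerivAt_monomial (α : ι →₀ ℕ) (p a : ι → ℂ) :
    HasDerivAt (fun t : ℂ => ∏ j, (p j + t * a j) ^ α j) (monomialDeriv α p a) 0 := by
  have h : DifferentiableAt ℂ (fun t : ℂ => ∏ j, (p j + t * a j) ^ α j) 0 := by fun_prop
  exact h.hasDerivAt

theorem monomialDeriv_star (α : ι →₀ ℕ) (p a : ι → ℂ) :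
    monomialDeriv α (star p) (star a) = star (monomialDeriv α p a) := by
  refine HasDerivAt.deriv ?_
  have h := (hasDerivAt_monomial α p a)
  rw [← star_zero ℂ] at h
  convert h.star_conj using 1
  · ext t
    simp [Function.comp_def, map_prod]
  · simp

variable [DecidableEq ι]

/-- The multinomial theorem, with the weights `d! / α!` dual to those of the unitarily invariant
product. -/
theorem sum_weight_mul_prod_pow (d : ℕ) (p q : ι → ℂ) :
    ∑ α ∈ (Finset.univ : Finset ι).finsuppAntidiag d,
      ((d ! : ℂ) / ∏ j, ((α j)! : ℂ)) * ((∏ j, p j ^ α j) * ∏ j, q j ^ α j) =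
      (∑ j, p j * q j) ^ d := by
  rw [Finset.sum_pow_eq_sum_piAntidiag]
  refine Finset.sum_bij (fun α _ => (α : ι → ℕ)) ?_ ?_ ?_ ?_
  · intro α hα
    simpa [Finset.mem_finsuppAntidiag, Finset.mem_piAntidiag] using hα
  · intro α _ β _ h
    exact DFunLike.coe_injective h
  · intro β hβ
    refine ⟨Finsupp.equivFunOnFinite.symm β, ?_, ?_⟩
    · simpa [Finset.mem_finsuppAntidiag, Finset.mem_piAntidiag] using hβ
    · rfl
  · intro α hα
    have hd : ∑ j, α j = d := (Finset.mem_finsuppAntidiag.1 hα).1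
    have h := Nat.multinomial_spec Finset.univ (α : ι → ℕ)
    rw [hd] at h
    have h' : (∏ j, ((α j)! : ℂ)) * (Nat.multinomial Finset.univ α : ℂ) = (d ! : ℂ) := by
      exact_mod_cast h
    have h0 : (∏ j, ((α j)! : ℂ)) ≠ 0 :=
      Finset.prod_ne_zero_iff.2 fun j _ => by exact_mod_cast (α j).factorial_ne_zero
    simp only [mul_pow, Finset.prod_mul_distrib]
    rw [← h', mul_div_cancel_left₀ _ h0]

theorem sum_weight_mul_monomialDeriv (d : ℕ) (p q b : ι → ℂ) :
    ∑ α ∈ (Finset.univ : Finset ι).finsuppAntidiag d,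
      ((d ! : ℂ) / ∏ j, ((α j)! : ℂ)) * ((∏ j, p j ^ α j) * monomialDeriv α q b) =
      d * (∑ j, p j * q j) ^ (d - 1) * ∑ j, p j * b j := by
  have h1 : HasDerivAt (fun t : ℂ => ∑ α ∈ (Finset.univ : Finset ι).finsuppAntidiag d,
      ((d ! : ℂ) / ∏ j, ((α j)! : ℂ)) * ((∏ j, p j ^ α j) * ∏ j, (q j + t * b j) ^ α j))
      (∑ α ∈ (Finset.univ : Finset ι).finsuppAntidiag d,
        ((d ! : ℂ) / ∏ j, ((α j)! : ℂ)) * ((∏ j, p j ^ α j) * monomialDeriv α q b)) 0 :=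
    HasDerivAt.fun_sum fun α _ => ((hasDerivAt_monomial α q b).const_mul _).const_mul _
  simp only [sum_weight_mul_prod_pow] at h1
  have h2 : HasDerivAt (fun t : ℂ => ∑ j, p j * (q j + t * b j)) (∑ j, p j * b j) 0 := by
    refine HasDerivAt.fun_sum fun j _ => HasDerivAt.const_mul _ ?_
    simpa using ((hasDerivAt_id (0 : ℂ)).mul_const (b j)).const_add (q j)
  simpa using h1.unique (h2.fun_pow d)

/-- The Bombieri–Weyl kernel `(p ⬝ q) ^ d` differentiated once in each argument: this is the inner
product of the representers of two directional derivatives. -/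
theorem sum_weight_mul_monomialDeriv_mul_monomialDeriv (d : ℕ) (p a q b : ι → ℂ) :
    ∑ α ∈ (Finset.univ : Finset ι).finsuppAntidiag d,
      ((d ! : ℂ) / ∏ j, ((α j)! : ℂ)) * (monomialDeriv α p a * monomialDeriv α q b) =
      d * ((d - 1 : ℕ) * (∑ j, p j * q j) ^ (d - 2) * (∑ j, a j * q j) * (∑ j, p j * b j) +
        (∑ j, p j * q j) ^ (d - 1) * ∑ j, a j * b j) := by
  have h1 : HasDerivAt (fun t : ℂ => ∑ α ∈ (Finset.univ : Finset ι).finsuppAntidiag d,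
      ((d ! : ℂ) / ∏ j, ((α j)! : ℂ)) * ((∏ j, (p j + t * a j) ^ α j) * monomialDeriv α q b))
      (∑ α ∈ (Finset.univ : Finset ι).finsuppAntidiag d,
        ((d ! : ℂ) / ∏ j, ((α j)! : ℂ)) * (monomialDeriv α p a * monomialDeriv α q b)) 0 :=
    HasDerivAt.fun_sum fun α _ => ((hasDerivAt_monomial α p a).mul_const _).const_mul _
  simp only [sum_weight_mul_monomialDeriv] at h1
  have h2 (c : ι → ℂ) :
      HasDerivAt (fun t : ℂ => ∑ j, (p j + t * a j) * c j) (∑ j, a j * c j) 0 := by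
    refine HasDerivAt.fun_sum fun j _ => HasDerivAt.mul_const ?_ _
    simpa using ((hasDerivAt_id (0 : ℂ)).mul_const (a j)).const_add (p j)
  have h3 := (((h2 q).fun_pow (d - 1)).const_mul (d : ℂ)).fun_mul (h2 b)
  rw [h1.unique h3]
  simp only [zero_mul, add_zero, Nat.sub_sub, Nat.reduceAdd]
  ring

end Kernel

section Representer

variable {m : ℕ}

/-- The kernel identity in terms of the Hermitian product. -/
theorem sum_weight_mul_monomialDeriv_mul_star (d : ℕ) (x w y v : EuclideanSpace ℂ (Fin m)) :
    ∑ α ∈ (Finset.univ : Finset (Fin m)).finsuppAntidiag d,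
      ((d ! : ℂ) / ∏ j, ((α j)! : ℂ)) * (monomialDeriv α x w * star (monomialDeriv α y v)) =
      d * ((d - 1 : ℕ) * ⟪y, x⟫_ℂ ^ (d - 2) * ⟪y, w⟫_ℂ * ⟪v, x⟫_ℂ +
        ⟪y, x⟫_ℂ ^ (d - 1) * ⟪v, w⟫_ℂ) := by
  simp only [← monomialDeriv_star, sum_weight_mul_monomialDeriv_mul_monomialDeriv,
    PiLp.inner_apply, RCLike.inner_apply', mul_comm, Pi.star_apply, starRingEnd_apply]

/-- The squared norm of the difference of the representers of two directional derivatives at unit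
vectors, in directions orthogonal to these vectors. -/
theorem sum_weight_mul_norm_sub_sq (d : ℕ) {x w y v : EuclideanSpace ℂ (Fin m)}
    (hx : ‖x‖ = 1) (hy : ‖y‖ = 1) (hw : ⟪x, w⟫_ℂ = 0) (hv : ⟪y, v⟫_ℂ = 0) :
    ∑ α ∈ (Finset.univ : Finset (Fin m)).finsuppAntidiag d,
      ((d ! : ℝ) / ∏ j, ((α j)! : ℝ)) * ‖monomialDeriv α x w - monomialDeriv α y v‖ ^ 2 =
      d * (‖w‖ ^ 2 + ‖v‖ ^ 2 - 2 * ((d - 1 : ℕ) * ⟪y, x⟫_ℂ ^ (d - 2) * ⟪y, w⟫_ℂ * ⟪v, x⟫_ℂ +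
        ⟪y, x⟫_ℂ ^ (d - 1) * ⟪v, w⟫_ℂ).re) := by
  have hxx : ⟪x, x⟫_ℂ = 1 := by simp [inner_self_eq_norm_sq_to_K, hx]
  have hyy : ⟪y, y⟫_ℂ = 1 := by simp [inner_self_eq_norm_sq_to_K, hy]
  have hww : (⟪w, w⟫_ℂ).re = ‖w‖ ^ 2 := (norm_sq_eq_re_inner (𝕜 := ℂ) w).symm
  have hvv : (⟪v, v⟫_ℂ).re = ‖v‖ ^ 2 := (norm_sq_eq_re_inner (𝕜 := ℂ) v).symm
  have key : ∀ α : Fin m →₀ ℕ,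
      ((d ! : ℝ) / ∏ j, ((α j)! : ℝ)) * ‖monomialDeriv α x w - monomialDeriv α y v‖ ^ 2 =
      (((d ! : ℂ) / ∏ j, ((α j)! : ℂ)) * (monomialDeriv α x w * star (monomialDeriv α x w))).re +
      (((d ! : ℂ) / ∏ j, ((α j)! : ℂ)) * (monomialDeriv α y v * star (monomialDeriv α y v))).re -
      2 * (((d ! : ℂ) / ∏ j, ((α j)! : ℂ)) *
        (monomialDeriv α x w * star (monomialDeriv α y v))).re := by
    intro α
    have hW : ((d ! : ℂ) / ∏ j, ((α j)! : ℂ)) = (((d ! : ℝ) / ∏ j, ((α j)! : ℝ) : ℝ) : ℂ) := by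
      push_cast; rfl
    rw [hW]
    generalize ((d ! : ℝ) / ∏ j, ((α j)! : ℝ)) = W
    simp only [Complex.ofReal_re, Complex.ofReal_im, ← Complex.normSq_eq_norm_sq, Complex.normSq_apply,
      Complex.sub_re, Complex.sub_im, Complex.mul_re, Complex.star_def, Complex.conj_re,
      Complex.conj_im]
    ring
  simp only [key, Finset.sum_sub_distrib, Finset.sum_add_distrib, ← Finset.mul_sum,
    ← Complex.re_sum, sum_weight_mul_monomialDeriv_mul_star, hxx, hyy, hw, hv, one_pow, mul_zero,
    zero_mul, zero_add, one_mul]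
  have hd : ∀ z : ℂ, ((d : ℂ) * z).re = d * z.re := fun z => by simp
  simp only [hd, hww, hvv]
  ring

end Representer

/-! ### Transporting the orthogonal complement of a line -/

section Transport

variable {E : Type*} [NormedAddCommGroup E] [InnerProductSpace ℂ E]

/-- For unit vectors `x`, `y` with `⟪x, y⟫ ≥ 0`, the map carrying `x^⊥` isometrically onto `y^⊥`:
on `x^⊥` it is the reflection in the orthogonal complement of `x + y`, which takes `x` to `-y`. -/
def transport (x y w : E) : E := w - (⟪y, w⟫_ℂ / (1 + ⟪x, y⟫_ℂ)) • (x + y)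

variable {x y w : E} {c : ℝ}

theorem one_add_ofReal_ne_zero (hc : 0 ≤ c) : (1 + c : ℂ) ≠ 0 := by
  exact_mod_cast (by positivity : (1 + c : ℝ) ≠ 0)

theorem inner_left_transport (hx : ‖x‖ = 1) (hxy : ⟪x, y⟫_ℂ = c) (hc : 0 ≤ c)
    (hw : ⟪x, w⟫_ℂ = 0) : ⟪x, transport x y w⟫_ℂ = -⟪y, w⟫_ℂ := by
  have h := one_add_ofReal_ne_zero hc
  simp only [transport, inner_sub_right, inner_smul_right, inner_add_right, hw, hxy,
    inner_self_eq_norm_sq_to_K, hx]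
  simp only [Complex.coe_algebraMap, Complex.ofReal_one]
  field_simp
  ring

theorem inner_right_transport (hy : ‖y‖ = 1) (hxy : ⟪x, y⟫_ℂ = c) (hc : 0 ≤ c) :
    ⟪y, transport x y w⟫_ℂ = 0 := by
  have h := one_add_ofReal_ne_zero hc
  have hyx : ⟪y, x⟫_ℂ = c := by rw [← inner_conj_symm, hxy]; simp
  simp only [transport, inner_sub_right, inner_smul_right, inner_add_right, hyx, hxy,
    inner_self_eq_norm_sq_to_K, hy]
  simp only [Complex.coe_algebraMap, Complex.ofReal_one]
  field_simp
  ring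

theorem transport_transport (hx : ‖x‖ = 1) (hxy : ⟪x, y⟫_ℂ = c) (hc : 0 ≤ c)
    (hw : ⟪x, w⟫_ℂ = 0) : transport y x (transport x y w) = w := by
  have hyx : ⟪y, x⟫_ℂ = c := by rw [← inner_conj_symm, hxy]; simp
  rw [transport, inner_left_transport hx hxy hc hw, hyx, transport, hxy, add_comm y x]
  module

theorem transport_inner (hxy : ⟪x, y⟫_ℂ = c) (hw : ⟪x, w⟫_ℂ = 0) :
    ⟪transport x y w, w⟫_ℂ = ((‖w‖ ^ 2 - ‖⟪y, w⟫_ℂ‖ ^ 2 / (1 + c) : ℝ) : ℂ) := by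
  simp only [transport, inner_sub_left, inner_smul_left, inner_add_left, hw, hxy, map_div₀,
    map_add, map_one, Complex.conj_ofReal, zero_add, inner_self_eq_norm_sq_to_K]
  rw [div_mul_eq_mul_div, Complex.conj_mul']
  push_cast
  rfl

theorem norm_transport (hx : ‖x‖ = 1) (hy : ‖y‖ = 1) (hxy : ⟪x, y⟫_ℂ = c) (hc : 0 ≤ c)
    (hw : ⟪x, w⟫_ℂ = 0) : ‖transport x y w‖ = ‖w‖ := by
  have h := one_add_ofReal_ne_zero hc
  have h1 : ⟪transport x y w, transport x y w⟫_ℂ = ⟪w, w⟫_ℂ := by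
    conv_lhs => arg 3; rw [transport]
    have h2 : ⟪transport x y w, x⟫_ℂ = -star ⟪y, w⟫_ℂ := by
      rw [← inner_conj_symm, inner_left_transport hx hxy hc hw]; simp
    have h3 : ⟪transport x y w, y⟫_ℂ = 0 := by
      rw [← inner_conj_symm, inner_right_transport hy hxy hc]; simp
    rw [inner_sub_right, inner_smul_right, inner_add_right, h2, h3, transport_inner hxy hw, hxy,
      inner_self_eq_norm_sq_to_K, add_zero, mul_neg, div_mul_eq_mul_div, Complex.star_def,
      Complex.mul_conj']
    push_cast
    simp
  rw [inner_self_eq_norm_sq_to_K, inner_self_eq_norm_sq_to_K] at h1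
  have h2 : ‖transport x y w‖ ^ 2 = ‖w‖ ^ 2 := by exact_mod_cast h1
  exact (sq_eq_sq₀ (norm_nonneg _) (norm_nonneg _)).1 h2

theorem norm_inner_sq_le_of_inner_eq_zero (hx : ‖x‖ = 1) (hy : ‖y‖ = 1) (hxy : ⟪x, y⟫_ℂ = c)
    (hw : ⟪x, w⟫_ℂ = 0) : ‖⟪y, w⟫_ℂ‖ ^ 2 ≤ (1 - c ^ 2) * ‖w‖ ^ 2 := by
  have hyx : ⟪y, x⟫_ℂ = c := by rw [← inner_conj_symm, hxy]; simp
  have h1 : ⟪y, w⟫_ℂ = ⟪y - (c : ℂ) • x, w⟫_ℂ := by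
    rw [inner_sub_left, inner_smul_left, hw]; simp
  have h2 : ‖y - (c : ℂ) • x‖ ^ 2 = 1 - c ^ 2 := by
    rw [norm_sub_sq (𝕜 := ℂ), inner_smul_right, hyx, norm_smul, hx, hy]
    simp [← Complex.ofReal_mul]
    ring
  rw [h1, ← h2, ← mul_pow]
  gcongr
  exact norm_inner_le_norm _ _

end Transport

/-- The real inequality behind the bound for the displacement of a representer; `c` stands for
`cos θ`, `W` for `‖w‖ ^ 2` and `B` for `‖⟪y, w⟫‖ ^ 2`. -/
theorem displacement_le {k : ℕ} {c θ W B : ℝ} (hc : 0 ≤ c) (hc1 : c ≤ 1)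
    (hθ : 1 - c ≤ θ ^ 2 / 2) (hB : 0 ≤ B) (hBW : B ≤ (1 - c ^ 2) * W) (hW : 0 ≤ W) :
    W + W - 2 * (-(k * c ^ (k - 1) * B) + c ^ k * (W - B / (1 + c))) ≤
      ((k + 1) * θ) ^ 2 * W := by
  have hp : c ^ (k - 1) ≤ 1 := pow_le_one₀ hc hc1
  have hq : 0 ≤ c ^ k := by positivity
  have h1 : B / (1 + c) ≤ (1 - c) * W := by
    rw [div_le_iff₀ (by positivity)]; linarith
  have h2 : c ^ k * (B / (1 + c)) ≤ c ^ k * ((1 - c) * W) := by gcongr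
  have h3 : k * c ^ (k - 1) * B ≤ k * ((1 - c ^ 2) * W) := by
    rw [mul_assoc]
    exact mul_le_mul_of_nonneg_left ((mul_le_of_le_one_left hB hp).trans hBW) k.cast_nonneg
  have h4 : 1 + ((k + 1 : ℕ) : ℝ) * (c - 1) ≤ (1 + (c - 1)) ^ (k + 1) :=
    one_add_mul_le_pow (by linarith) _
  have h5 : 1 - c ^ (k + 1) ≤ (k + 1) * (1 - c) := by
    push_cast at h4
    rw [add_sub_cancel] at h4
    linarith
  have h6 : (1 - c ^ (k + 1)) * W ≤ (k + 1) * (1 - c) * W := by gcongr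
  have h7 : (1 - c ^ 2) * W ≤ 2 * (1 - c) * W := by
    gcongr; nlinarith
  have h8 : (k : ℝ) * ((1 - c ^ 2) * W) ≤ k * (2 * (1 - c) * W) := by gcongr
  have h9 : (1 - c) * W ≤ θ ^ 2 / 2 * W := by gcongr
  have h10 : (3 * k + 1) * ((1 - c) * W) ≤ (3 * k + 1) * (θ ^ 2 / 2 * W) := by gcongr
  have h11 : (3 * k + 1 : ℝ) ≤ (k + 1) ^ 2 := by
    rcases k with _ | k
    · norm_num
    · have : (0 : ℝ) ≤ k := by positivity
      push_cast
      nlinarith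
  have h12 : (3 * k + 1) * (θ ^ 2 * W) ≤ (k + 1) ^ 2 * (θ ^ 2 * W) := by gcongr
  rw [pow_succ] at h6
  nlinarith

/-- Moving the base point by an angle `θ` displaces the representer of a directional derivative of
degree `d` polynomials by at most `√d * (d * θ) * ‖w‖`. -/
theorem sum_weight_mul_norm_sub_transport_sq_le {m d : ℕ} (hd : 1 ≤ d)
    {x y w : EuclideanSpace ℂ (Fin m)} {c θ : ℝ} (hx : ‖x‖ = 1) (hy : ‖y‖ = 1)
    (hxy : ⟪x, y⟫_ℂ = c) (hc : 0 ≤ c) (hθ : 1 - c ≤ θ ^ 2 / 2) (hw : ⟪x, w⟫_ℂ = 0) :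
    ∑ α ∈ (Finset.univ : Finset (Fin m)).finsuppAntidiag d, ((d ! : ℝ) / ∏ j, ((α j)! : ℝ)) *
      ‖monomialDeriv α x w - monomialDeriv α y (transport x y w).ofLp‖ ^ 2 ≤
      d * ((d * θ) ^ 2 * ‖w‖ ^ 2) := by
  obtain ⟨k, rfl⟩ : ∃ k, d = k + 1 := ⟨d - 1, by omega⟩
  have hyx : ⟪y, x⟫_ℂ = c := by rw [← inner_conj_symm, hxy]; simp
  have hc1 : c ≤ 1 := by
    have := norm_inner_le_norm (𝕜 := ℂ) x y
    rw [hxy, hx, hy] at this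
    simpa [abs_of_nonneg hc] using this
  rw [sum_weight_mul_norm_sub_sq _ hx hy hw (inner_right_transport hy hxy hc),
    norm_transport hx hy hxy hc hw, transport_inner hxy hw, hyx, ← inner_conj_symm _ x,
    inner_left_transport hx hxy hc hw, map_neg, mul_neg, mul_assoc, Complex.mul_conj']
  refine mul_le_mul_of_nonneg_left ?_ (by positivity)
  have h := displacement_le (k := k) hc hc1 hθ (sq_nonneg ‖⟪y, w⟫_ℂ‖)
    (norm_inner_sq_le_of_inner_eq_zero hx hy hxy hw) (sq_nonneg ‖w‖)
  have hk : k + 1 - 2 = k - 1 := by omega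
  rw [hk, Nat.add_sub_cancel]
  push_cast
  exact_mod_cast h

/-- The representer of the derivative at a unit vector `x` in a direction `w ⊥ x` has norm
`√d * ‖w‖`. -/
theorem sum_weight_mul_norm_sq {m d : ℕ} {x w : EuclideanSpace ℂ (Fin m)} (hx : ‖x‖ = 1)
    (hw : ⟪x, w⟫_ℂ = 0) :
    ∑ α ∈ (Finset.univ : Finset (Fin m)).finsuppAntidiag d,
      ((d ! : ℝ) / ∏ j, ((α j)! : ℝ)) * ‖monomialDeriv α x w‖ ^ 2 = d * ‖w‖ ^ 2 := by
  have h0 (α : Fin m →₀ ℕ) : monomialDeriv α x (0 : Fin m → ℂ) = 0 := by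
    simp [monomialDeriv]
  have h := sum_weight_mul_norm_sub_sq d hx hx hw (inner_zero_right x)
  simpa [h0] using h

/-! ### Derivatives of systems and the Bombieri–Weyl norm -/

section System

variable {n : ℕ} {d : Fin n → ℕ}

theorem mem_finsuppAntidiag_of_coeff_ne_zero (f : HomSystem d) {i : Fin n}
    {α : Fin (n + 1) →₀ ℕ} (hα : (f i : MvPolynomial (Fin (n + 1)) ℂ).coeff α ≠ 0) :
    α ∈ (Finset.univ : Finset (Fin (n + 1))).finsuppAntidiag (d i) := by
  have h : α.degree = d i :=
    (DFunLike.congr_fun Finsupp.degree_eq_weight_one α).trans ((f i).2 hα)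
  rw [Finsupp.degree_eq_sum] at h
  exact Finset.mem_finsuppAntidiag.2 ⟨h, Finset.subset_univ _⟩

theorem toMap_apply (f : HomSystem d) (z : EuclideanSpace ℂ (Fin (n + 1))) (i : Fin n) :
    toMap f z i = ∑ α ∈ (Finset.univ : Finset (Fin (n + 1))).finsuppAntidiag (d i),
      (f i : MvPolynomial (Fin (n + 1)) ℂ).coeff α * ∏ j, z j ^ α j := by
  have h : toMap f z i =
      MvPolynomial.eval (fun j => z j) (f i : MvPolynomial (Fin (n + 1)) ℂ) := rfl
  rw [h, MvPolynomial.eval_eq']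
  refine Finset.sum_subset ?_ ?_
  · intro α hα
    exact mem_finsuppAntidiag_of_coeff_ne_zero f (MvPolynomial.mem_support_iff.1 hα)
  · intro α _ hα
    rw [MvPolynomial.notMem_support_iff.1 hα, zero_mul]

theorem differentiable_toMap (f : HomSystem d) : Differentiable ℂ (toMap f) := by
  rw [differentiable_euclidean]
  intro i
  simp only [toMap_apply]
  fun_prop

theorem hasDerivAt_toMap_line (f : HomSystem d) (x w : EuclideanSpace ℂ (Fin (n + 1)))
    (i : Fin n) :
    HasDerivAt (fun t : ℂ => toMap f (x + t • w) i) (fderiv ℂ (toMap f) x w i) 0 := by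
  have h1 : HasDerivAt (fun t : ℂ => x + t • w) w 0 := by
    simpa using ((hasDerivAt_id (0 : ℂ)).smul_const w).const_add x
  have h2 : HasFDerivAt (toMap f) (fderiv ℂ (toMap f) x) (x + (0 : ℂ) • w) := by
    simpa using (differentiable_toMap f x).hasFDerivAt
  have h3 := h2.comp_hasDerivAt (0 : ℂ) h1
  exact (EuclideanSpace.proj (𝕜 := ℂ) i).hasFDerivAt.comp_hasDerivAt (0 : ℂ) h3

theorem fderiv_toMap_apply (f : HomSystem d) (x w : EuclideanSpace ℂ (Fin (n + 1))) (i : Fin n) :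
    fderiv ℂ (toMap f) x w i =
      ∑ α ∈ (Finset.univ : Finset (Fin (n + 1))).finsuppAntidiag (d i),
        (f i : MvPolynomial (Fin (n + 1)) ℂ).coeff α * monomialDeriv α x w := by
  have h := hasDerivAt_toMap_line f x w i
  simp only [toMap_apply] at h
  exact h.unique (HasDerivAt.fun_sum fun α _ => (hasDerivAt_monomial α x w).const_mul _)

theorem toMap_smul (f : HomSystem d) (l : ℂ) (z : EuclideanSpace ℂ (Fin (n + 1))) (i : Fin n) :
    toMap f (l • z) i = l ^ d i * toMap f z i := by
  rw [toMap_apply, toMap_apply, Finset.mul_sum]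
  refine Finset.sum_congr rfl fun α hα => ?_
  have hd : ∑ j, α j = d i := (Finset.mem_finsuppAntidiag.1 hα).1
  simp only [PiLp.smul_apply, smul_eq_mul, mul_pow, Finset.prod_mul_distrib,
    Finset.prod_pow_eq_pow_sum, hd]
  ring

theorem fderiv_toMap_smul (f : HomSystem d) {l : ℂ} (hl : l ≠ 0)
    (x w : EuclideanSpace ℂ (Fin (n + 1))) {i : Fin n} (hd : 1 ≤ d i) :
    fderiv ℂ (toMap f) (l • x) w i = l ^ (d i - 1) * fderiv ℂ (toMap f) x w i := by
  have h1 := hasDerivAt_toMap_line f (l • x) w i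
  have h2 := (hasDerivAt_toMap_line f x (l⁻¹ • w) i).const_mul (l ^ d i)
  have h3 : (fun t : ℂ => toMap f (l • x + t • w) i) =
      fun t : ℂ => l ^ d i * toMap f (x + t • l⁻¹ • w) i := by
    ext t
    rw [← toMap_smul, smul_add, smul_comm t, smul_inv_smul₀ hl]
  rw [h3] at h1
  rw [h1.unique h2, map_smul, PiLp.smul_apply, smul_eq_mul, ← mul_assoc]
  obtain ⟨k, hk⟩ : ∃ k, d i = k + 1 := ⟨d i - 1, by omega⟩
  rw [hk, Nat.add_sub_cancel, pow_succ, mul_assoc (l ^ k), mul_inv_cancel₀ hl, mul_one]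

/-- The squared Bombieri–Weyl norm of one component of a system. -/
def compNormSq (f : HomSystem d) (i : Fin n) : ℝ :=
  ∑ α ∈ (Finset.univ : Finset (Fin (n + 1))).finsuppAntidiag (d i),
    ((∏ j, ((α j)! : ℝ)) / ((d i)! : ℝ)) *
      ‖(f i : MvPolynomial (Fin (n + 1)) ℂ).coeff α‖ ^ 2

theorem compNormSq_nonneg (f : HomSystem d) (i : Fin n) : 0 ≤ compNormSq f i :=
  Finset.sum_nonneg fun _ _ => by positivity

theorem sysNorm_sq (f : HomSystem d) : sysNorm f ^ 2 = ∑ i, compNormSq f i := by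
  have h : (sysInner f f).re = ∑ i, compNormSq f i := by
    simp only [sysInner, compNormSq, Complex.re_sum]
    refine Finset.sum_congr rfl fun i _ => Finset.sum_congr rfl fun α _ => ?_
    have hW : ((∏ j, ((α j)! : ℂ)) / ((d i)! : ℂ)) =
        (((∏ j, ((α j)! : ℝ)) / ((d i)! : ℝ) : ℝ) : ℂ) := by
      push_cast; rfl
    rw [Complex.star_def, Complex.mul_conj', hW, Complex.re_ofReal_mul]
    norm_cast
  rw [sysNorm, h, Real.sq_sqrt (Finset.sum_nonneg fun i _ => compNormSq_nonneg f i)]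

theorem sysNorm_nonneg (f : HomSystem d) : 0 ≤ sysNorm f := Real.sqrt_nonneg _

theorem sysNorm_pos {f : HomSystem d} (hf : f ≠ 0) : 0 < sysNorm f := by
  refine (sysNorm_nonneg f).lt_of_ne' fun h => hf ?_
  have h1 := sysNorm_sq f
  rw [h, zero_pow two_ne_zero, eq_comm,
    Finset.sum_eq_zero_iff_of_nonneg fun i _ => compNormSq_nonneg f i] at h1
  ext i α
  have h2 := h1 i (Finset.mem_univ i)
  rw [compNormSq, Finset.sum_eq_zero_iff_of_nonneg fun α _ => by positivity] at h2
  by_cases hα : α ∈ (Finset.univ : Finset (Fin (n + 1))).finsuppAntidiag (d i)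
  · have h3 := h2 α hα
    have h4 : (0 : ℝ) < (∏ j, ((α j)! : ℝ)) / ((d i)! : ℝ) := by positivity
    simpa [h4.ne'] using h3
  · by_contra h3
    exact hα (mem_finsuppAntidiag_of_coeff_ne_zero f h3)

theorem sysNorm_smul (l : ℂ) (f : HomSystem d) : sysNorm (l • f) = ‖l‖ * sysNorm f := by
  refine (sq_eq_sq₀ (sysNorm_nonneg _) (mul_nonneg (norm_nonneg _) (sysNorm_nonneg _))).1 ?_
  rw [mul_pow, sysNorm_sq, sysNorm_sq, Finset.mul_sum]
  refine Finset.sum_congr rfl fun i _ => ?_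
  rw [compNormSq, compNormSq, Finset.mul_sum]
  refine Finset.sum_congr rfl fun α _ => ?_
  simp only [Pi.smul_apply, Submodule.coe_smul, MvPolynomial.coeff_smul, smul_eq_mul, norm_mul]
  ring

theorem sysNorm_normalize {f : HomSystem d} (hf : f ≠ 0) : sysNorm (normalize f) = 1 := by
  have h := sysNorm_pos hf
  rw [normalize, sysNorm_smul, Complex.norm_real, Real.norm_of_nonneg (by positivity),
    inv_mul_cancel₀ h.ne']

/-- The Cauchy–Schwarz inequality for the unitarily invariant product and its dual weights. -/
theorem norm_sum_coeff_mul_sq_le (f : HomSystem d) (i : Fin n) (κ : (Fin (n + 1) →₀ ℕ) → ℂ) :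
    ‖∑ α ∈ (Finset.univ : Finset (Fin (n + 1))).finsuppAntidiag (d i),
      (f i : MvPolynomial (Fin (n + 1)) ℂ).coeff α * κ α‖ ^ 2 ≤
    compNormSq f i * ∑ α ∈ (Finset.univ : Finset (Fin (n + 1))).finsuppAntidiag (d i),
      (((d i)! : ℝ) / ∏ j, ((α j)! : ℝ)) * ‖κ α‖ ^ 2 := by
  refine (pow_le_pow_left₀ (norm_nonneg _) (norm_sum_le _ _) 2).trans ?_
  refine Finset.sum_sq_le_sum_mul_sum_of_sq_le_mul _ (fun _ _ => by positivity)
    (fun _ _ => by positivity) fun α _ => ?_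
  have h1 : ((d i)! : ℝ) ≠ 0 := by positivity
  have h2 : (∏ j, ((α j)! : ℝ)) ≠ 0 := by positivity
  rw [norm_mul]
  refine le_of_eq ?_
  field_simp

end System

/-! ### The scaled derivative -/

section Scaled

variable {n : ℕ} {d : Fin n → ℕ}

/-- The vector `diag (√d_i ‖x‖^{d_i - 1})⁻¹ Df(x) w`. -/
def scaledDeriv (f : HomSystem d) (x w : EuclideanSpace ℂ (Fin (n + 1))) :
    EuclideanSpace ℂ (Fin n) :=
  WithLp.toLp 2 fun i =>
    fderiv ℂ (toMap f) x w i / ((√(d i : ℝ) * ‖x‖ ^ (d i - 1) : ℝ) : ℂ)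

theorem scaledDeriv_sub_left (f g : HomSystem d) (x w : EuclideanSpace ℂ (Fin (n + 1))) :
    scaledDeriv (f - g) x w = scaledDeriv f x w - scaledDeriv g x w := by
  ext i
  simp only [scaledDeriv, fderiv_toMap_apply, PiLp.sub_apply, ← sub_div,
    ← Finset.sum_sub_distrib, ← sub_mul]
  rfl

theorem scaledDeriv_smul_left (l : ℂ) (f : HomSystem d) (x w : EuclideanSpace ℂ (Fin (n + 1))) :
    scaledDeriv (l • f) x w = l • scaledDeriv f x w := by
  ext i
  simp only [scaledDeriv, fderiv_toMap_apply, PiLp.smul_apply, smul_eq_mul, ← mul_div_assoc,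
    Finset.mul_sum, ← mul_assoc]
  rfl

theorem norm_scaledDeriv_smul (hd : ∀ i, 1 ≤ d i) (f : HomSystem d) {l : ℂ} (hl : l ≠ 0)
    (x w : EuclideanSpace ℂ (Fin (n + 1))) :
    ‖scaledDeriv f (l • x) w‖ = ‖scaledDeriv f x w‖ := by
  rw [EuclideanSpace.norm_eq, EuclideanSpace.norm_eq]
  congr 1
  refine Finset.sum_congr rfl fun i _ => ?_
  congr 1
  have h : ‖l‖ ^ (d i - 1) ≠ 0 := pow_ne_zero _ (norm_ne_zero_iff.2 hl)
  simp only [scaledDeriv, fderiv_toMap_smul f hl x w (hd i), norm_div, norm_mul, norm_pow,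
    norm_smul, mul_pow, Complex.norm_real, norm_norm]
  rw [mul_left_comm, mul_div_mul_left _ _ h]

theorem norm_le_sysNorm_mul_of_sq_le (f : HomSystem d) {a : EuclideanSpace ℂ (Fin n)} {r : ℝ}
    (hr : 0 ≤ r) (h : ∀ i, ‖a i‖ ^ 2 ≤ compNormSq f i * r ^ 2) : ‖a‖ ≤ sysNorm f * r := by
  refine (sq_le_sq₀ (norm_nonneg _) (mul_nonneg (sysNorm_nonneg f) hr)).1 ?_
  rw [mul_pow, sysNorm_sq, Finset.sum_mul, EuclideanSpace.norm_sq_eq]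
  exact Finset.sum_le_sum fun i _ => h i

theorem norm_scaledDeriv_le (hd : ∀ i, 1 ≤ d i) (f : HomSystem d)
    {x w : EuclideanSpace ℂ (Fin (n + 1))} (hx : ‖x‖ = 1) (hw : ⟪x, w⟫_ℂ = 0) :
    ‖scaledDeriv f x w‖ ≤ sysNorm f * ‖w‖ := by
  refine norm_le_sysNorm_mul_of_sq_le f (norm_nonneg w) fun i => ?_
  have hdi : (0 : ℝ) < d i := by exact_mod_cast hd i
  have h := norm_sum_coeff_mul_sq_le f i fun α => monomialDeriv α x w
  rw [sum_weight_mul_norm_sq hx hw] at h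
  simp only [scaledDeriv, fderiv_toMap_apply, hx, one_pow, mul_one, norm_div, Complex.norm_real,
    div_pow, Real.norm_eq_abs, sq_abs, Real.sq_sqrt hdi.le]
  rw [div_le_iff₀ hdi]
  linarith

theorem norm_scaledDeriv_sub_transport_le (hd : ∀ i, 1 ≤ d i) (g : HomSystem d)
    {x y w : EuclideanSpace ℂ (Fin (n + 1))} {c θ : ℝ} (hx : ‖x‖ = 1) (hy : ‖y‖ = 1)
    (hxy : ⟪x, y⟫_ℂ = c) (hc : 0 ≤ c) (hθ0 : 0 ≤ θ) (hθ : 1 - c ≤ θ ^ 2 / 2)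
    (hw : ⟪x, w⟫_ℂ = 0) :
    ‖scaledDeriv g x w - scaledDeriv g y (transport x y w)‖ ≤
      sysNorm g * (maxDeg d * θ * ‖w‖) := by
  refine norm_le_sysNorm_mul_of_sq_le g (by positivity) fun i => ?_
  have hdi : (0 : ℝ) < d i := by exact_mod_cast hd i
  have hdD : (d i : ℝ) ≤ maxDeg d := by
    exact_mod_cast Finset.le_sup (f := d) (Finset.mem_univ i)
  have h := norm_sum_coeff_mul_sq_le g i
    fun α => monomialDeriv α x w - monomialDeriv α y (transport x y w).ofLp
  have h1 := mul_le_mul_of_nonneg_left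
    (sum_weight_mul_norm_sub_transport_sq_le (hd i) hx hy hxy hc hθ hw) (compNormSq_nonneg g i)
  have h2 : ((d i : ℝ) * θ) ^ 2 * ‖w‖ ^ 2 ≤ (maxDeg d * θ * ‖w‖) ^ 2 := by
    rw [← mul_pow]; gcongr
  have h3 := mul_le_mul_of_nonneg_left h2 (mul_nonneg hdi.le (compNormSq_nonneg g i))
  simp only [PiLp.sub_apply, scaledDeriv, fderiv_toMap_apply, hx, hy, one_pow, mul_one, ← sub_div,
    ← Finset.sum_sub_distrib, ← mul_sub, norm_div, Complex.norm_real,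
    div_pow, Real.norm_eq_abs, sq_abs, Real.sq_sqrt hdi.le]
  rw [div_le_iff₀ hdi]
  linarith

/-- The scaled derivative is Lipschitz in the system and in the point; this is the estimate which
makes `1 / μ` Lipschitz. -/
theorem norm_scaledDeriv_sub_scaledDeriv_transport_le (hd : ∀ i, 1 ≤ d i) (f g : HomSystem d)
    {x y w : EuclideanSpace ℂ (Fin (n + 1))} {c θ : ℝ} (hx : ‖x‖ = 1) (hy : ‖y‖ = 1)
    (hxy : ⟪x, y⟫_ℂ = c) (hc : 0 ≤ c) (hθ0 : 0 ≤ θ) (hθ : 1 - c ≤ θ ^ 2 / 2)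
    (hw : ⟪x, w⟫_ℂ = 0) :
    ‖scaledDeriv f x w - scaledDeriv g y (transport x y w)‖ ≤
      (sysNorm (f - g) + sysNorm g * (maxDeg d * θ)) * ‖w‖ := by
  have h1 := norm_scaledDeriv_le hd (f - g) hx hw
  have h2 := norm_scaledDeriv_sub_transport_le hd g hx hy hxy hc hθ0 hθ hw
  rw [scaledDeriv_sub_left] at h1
  calc _ ≤ _ := norm_sub_le_norm_sub_add_norm_sub _ (scaledDeriv g x w) _
    _ ≤ _ := add_le_add h1 h2
    _ = _ := by ring

end Scaled

/-! ### The condition number as an optimal constant -/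

section Condition

variable {n : ℕ} {d : Fin n → ℕ}

theorem diagEntry_ne_zero {E : Type*} [NormedAddCommGroup E] {k : ℕ} (hk : 1 ≤ k) {x : E}
    (hx : x ≠ 0) : ((√(k : ℝ) * ‖x‖ ^ (k - 1) : ℝ) : ℂ) ≠ 0 := by
  have h1 : 0 < √(k : ℝ) := Real.sqrt_pos.2 (by exact_mod_cast hk)
  have h2 : 0 < ‖x‖ := norm_pos_iff.2 hx
  exact_mod_cast (by positivity : √(k : ℝ) * ‖x‖ ^ (k - 1) ≠ 0)

theorem diagOp_scaledDeriv (hd : ∀ i, 1 ≤ d i) (f : HomSystem d)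
    {x : EuclideanSpace ℂ (Fin (n + 1))} (hx : x ≠ 0) (w : EuclideanSpace ℂ (Fin (n + 1))) :
    diagOp d x (scaledDeriv f x w) = fderiv ℂ (toMap f) x w := by
  ext i
  simp only [diagOp, Matrix.ofLp_toEuclideanCLM, Matrix.mulVec_diagonal, scaledDeriv]
  rw [mul_div_cancel₀ _ (diagEntry_ne_zero (hd i) hx)]

theorem finrank_orthogonal_singleton {x : EuclideanSpace ℂ (Fin (n + 1))} (hx : x ≠ 0) :
    Module.finrank ℂ (ℂ ∙ x)ᗮ = n := by
  have : Fact (Module.finrank ℂ (EuclideanSpace ℂ (Fin (n + 1))) = n + 1) := ⟨by simp⟩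
  exact Submodule.finrank_orthogonal_span_singleton hx

theorem rankPerp_eq_iff_surjective {f : HomSystem d} {x : EuclideanSpace ℂ (Fin (n + 1))} :
    rankPerp f x = n ↔ Function.Surjective (derivPerp f x).toLinearMap := by
  rw [← LinearMap.range_eq_top, rankPerp]
  refine ⟨fun h => Submodule.eq_top_of_finrank_eq (by simpa using h), fun h => ?_⟩
  rw [h]
  simp

theorem isInvertible_derivPerp {f : HomSystem d} {x : EuclideanSpace ℂ (Fin (n + 1))}
    (hx : x ≠ 0) (h : rankPerp f x = n) : (derivPerp f x).IsInvertible := by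
  have hs := rankPerp_eq_iff_surjective.1 h
  have hi := (LinearMap.injective_iff_surjective_of_finrank_eq_finrank
    (by simp [finrank_orthogonal_singleton hx])).2 hs
  exact ⟨(LinearEquiv.ofBijective _ ⟨hi, hs⟩).toContinuousLinearEquiv, by ext; rfl⟩

/-- `M` bounds the inverse of the scaled derivative of `f` at `x` on `x^⊥`. Stated as a lower bound
for the scaled derivative, this needs no inverse, and implies full rank. -/
def IsCondBound (f : HomSystem d) (x : EuclideanSpace ℂ (Fin (n + 1))) (M : ℝ) : Prop :=
  ∀ w, ⟪x, w⟫_ℂ = 0 → ‖w‖ ≤ M * ‖scaledDeriv f x w‖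

theorem isCondBound_smul_iff (hd : ∀ i, 1 ≤ d i) {f : HomSystem d}
    {x : EuclideanSpace ℂ (Fin (n + 1))} {M : ℝ} {l : ℂ} (hl : l ≠ 0) :
    IsCondBound f (l • x) M ↔ IsCondBound f x M := by
  simp only [IsCondBound, norm_scaledDeriv_smul hd f hl, inner_smul_left, mul_eq_zero,
    map_eq_zero, hl, false_or]

theorem isCondBound_normalize_iff {f : HomSystem d} (hf : f ≠ 0)
    {x : EuclideanSpace ℂ (Fin (n + 1))} {M : ℝ} :
    IsCondBound (normalize f) x (sysNorm f * M) ↔ IsCondBound f x M := by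
  have h := sysNorm_pos hf
  have h1 (w : EuclideanSpace ℂ (Fin (n + 1))) :
      sysNorm f * M * ‖scaledDeriv (normalize f) x w‖ = M * ‖scaledDeriv f x w‖ := by
    rw [normalize, scaledDeriv_smul_left, norm_smul, Complex.norm_real,
      Real.norm_of_nonneg (by positivity)]
    field_simp
  simp only [IsCondBound, h1]

theorem IsCondBound.rankPerp_eq {f : HomSystem d}
    {x : EuclideanSpace ℂ (Fin (n + 1))} (hx : x ≠ 0) {M : ℝ} (h : IsCondBound f x M) :
    rankPerp f x = n := by
  rw [rankPerp_eq_iff_surjective, ← LinearMap.injective_iff_surjective_of_finrank_eq_finrank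
    (by simp [finrank_orthogonal_singleton hx]), injective_iff_map_eq_zero]
  intro w hw
  have h1 := h w (Submodule.mem_orthogonal_singleton_iff_inner_right.1 w.2)
  have h2 : fderiv ℂ (toMap f) x w = 0 := hw
  have h3 : scaledDeriv f x w = 0 := by
    ext i
    simp [scaledDeriv, h2]
  rw [h3, norm_zero, mul_zero] at h1
  exact Subtype.ext (norm_le_zero_iff.1 h1)

theorem isCondBound_norm_inverse (hd : ∀ i, 1 ≤ d i) {f : HomSystem d}
    {x : EuclideanSpace ℂ (Fin (n + 1))} (hx : x ≠ 0) (h : rankPerp f x = n) :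
    IsCondBound f x ‖(derivPerp f x).inverse.comp (diagOp d x)‖ := by
  intro w hw
  have h1 : (derivPerp f x).inverse.comp (diagOp d x) (scaledDeriv f x w) =
      (⟨w, Submodule.mem_orthogonal_singleton_iff_inner_right.2 hw⟩ : (ℂ ∙ x)ᗮ) := by
    rw [ContinuousLinearMap.comp_apply, diagOp_scaledDeriv hd f hx,
      (isInvertible_derivPerp hx h).inverse_apply_eq]
    rfl
  have h2 := ((derivPerp f x).inverse.comp (diagOp d x)).le_opNorm (scaledDeriv f x w)
  rw [h1] at h2
  exact h2

theorem IsCondBound.norm_inverse_le (hd : ∀ i, 1 ≤ d i) {f : HomSystem d}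
    {x : EuclideanSpace ℂ (Fin (n + 1))} (hx : x ≠ 0) {M : ℝ} (hM : 0 ≤ M)
    (h : IsCondBound f x M) : ‖(derivPerp f x).inverse.comp (diagOp d x)‖ ≤ M := by
  have hr := h.rankPerp_eq hx
  have hL := isInvertible_derivPerp hx hr
  refine ContinuousLinearMap.opNorm_le_bound _ hM fun b => ?_
  set w := (derivPerp f x).inverse (diagOp d x b) with hw
  have h1 : diagOp d x b = fderiv ℂ (toMap f) x w := (hL.inverse_apply_eq.1 hw.symm)
  have h2 : scaledDeriv f x w = b := by
    ext i
    simp only [scaledDeriv, ← h1, diagOp, Matrix.ofLp_toEuclideanCLM, Matrix.mulVec_diagonal]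
    rw [mul_div_cancel_left₀ _ (diagEntry_ne_zero (hd i) hx)]
  have h3 := h w (Submodule.mem_orthogonal_singleton_iff_inner_right.1 w.2)
  rw [h2] at h3
  exact h3

/-- When the derivative has full rank, `μ(f, x)` is the least bound for the inverse of the scaled
derivative of the normalized system. -/
theorem exists_condNumber_eq (hd : ∀ i, 1 ≤ d i) {f : HomSystem d} (hf : f ≠ 0)
    {x : EuclideanSpace ℂ (Fin (n + 1))} (hx : x ≠ 0) (h : rankPerp f x = n) :
    ∃ m : ℝ, 0 ≤ m ∧ condNumber f x = ENNReal.ofReal m ∧ IsCondBound (normalize f) x m ∧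
      ∀ M, 0 ≤ M → IsCondBound (normalize f) x M → m ≤ M := by
  have hp := sysNorm_pos hf
  refine ⟨_, by positivity, if_pos h,
    (isCondBound_normalize_iff hf).2 (isCondBound_norm_inverse hd hx h), fun M hM hb => ?_⟩
  rw [← mul_div_cancel₀ M hp.ne', isCondBound_normalize_iff hf] at hb
  have h1 := hb.norm_inverse_le hd hx (by positivity)
  rwa [le_div_iff₀' hp] at h1

/-- A bound `m` for `f` at `x` gives a bound for `g` at `y`; read for the least bounds `μ`, it says
that `1 / μ` is Lipschitz, with constant `1` in the system and `D` in the point. -/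
theorem IsCondBound.perturb (hd : ∀ i, 1 ≤ d i) {f g : HomSystem d} (hg : sysNorm g = 1)
    {x y : EuclideanSpace ℂ (Fin (n + 1))} {c θ m : ℝ} (hx : ‖x‖ = 1) (hy : ‖y‖ = 1)
    (hxy : ⟪x, y⟫_ℂ = c) (hc : 0 ≤ c) (hθ0 : 0 ≤ θ) (hθ : 1 - c ≤ θ ^ 2 / 2) (hm : 0 ≤ m)
    (hη : m * (sysNorm (f - g) + maxDeg d * θ) < 1) (h : IsCondBound f x m) :
    IsCondBound g y (m / (1 - m * (sysNorm (f - g) + maxDeg d * θ))) := by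
  intro v hv
  have hyx : ⟪y, x⟫_ℂ = c := by rw [← inner_conj_symm, hxy]; simp
  have h1 : ⟪x, transport y x v⟫_ℂ = 0 := inner_right_transport hx hyx hc
  have h2 := h _ h1
  have h3 := norm_scaledDeriv_sub_scaledDeriv_transport_le hd f g hx hy hxy hc hθ0 hθ h1
  rw [norm_transport hy hx hyx hc hv] at h2 h3
  rw [transport_transport hy hyx hc hv, hg, one_mul] at h3
  have h4 := norm_le_norm_add_norm_sub' (scaledDeriv f x (transport y x v)) (scaledDeriv g y v)
  have h5 := mul_le_mul_of_nonneg_left (h4.trans (add_le_add_right h3 _)) hm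
  rw [div_mul_eq_mul_div, le_div_iff₀ (by linarith)]
  linarith

end Condition

/-- Nonzero vectors can be rescaled to unit vectors whose inner product is real and equals the
cosine of the angle between the lines they span. -/
theorem exists_smul_inner_eq {E : Type*} [NormedAddCommGroup E] [InnerProductSpace ℂ E] {x y : E}
    (hx : x ≠ 0) (hy : y ≠ 0) :
    ∃ a b : ℂ, a ≠ 0 ∧ b ≠ 0 ∧ ‖a • x‖ = 1 ∧ ‖b • y‖ = 1 ∧
      ⟪a • x, b • y⟫_ℂ = ((‖⟪x, y⟫_ℂ‖ / (‖x‖ * ‖y‖) : ℝ) : ℂ) := by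
  have hx' := norm_pos_iff.2 hx
  have hy' := norm_pos_iff.2 hy
  obtain ⟨u, hu, hu'⟩ : ∃ u : ℂ, ‖u‖ = 1 ∧ u * ⟪x, y⟫_ℂ = (‖⟪x, y⟫_ℂ‖ : ℂ) :=
    (RCLike.exists_norm_eq_mul_self ⟪x, y⟫_ℂ).imp fun _ h => ⟨h.1, h.2.symm⟩
  have hu0 : u ≠ 0 := norm_ne_zero_iff.1 (by simp [hu])
  refine ⟨((‖x‖⁻¹ : ℝ) : ℂ), u * ((‖y‖⁻¹ : ℝ) : ℂ), ?_, ?_, ?_, ?_, ?_⟩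
  · exact_mod_cast (inv_pos.2 hx').ne'
  · exact mul_ne_zero hu0 (by exact_mod_cast (inv_pos.2 hy').ne')
  · rw [norm_smul, Complex.norm_real, norm_inv, norm_norm, inv_mul_cancel₀ hx'.ne']
  · rw [norm_smul, norm_mul, hu, Complex.norm_real, norm_inv, norm_norm, one_mul,
      inv_mul_cancel₀ hy'.ne']
  · rw [inner_smul_left, inner_smul_right, Complex.conj_ofReal, mul_right_comm u, hu']
    push_cast
    field_simp

end PolySys
end

theorem corollary1 (n : ℕ) (hn : 2 ≤ n) (d : Fin n → ℕ) (hd : ∀ i, 1 ≤ d i)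
    (hD : 2 ≤ PolySys.maxDeg d) (ε : ℝ) (hε0 : 0 < ε) (hε : ε ≤ 1 / 4)
    (f g : PolySys.HomSystem d) (hf : f ≠ 0) (hg : g ≠ 0)
    (x y : EuclideanSpace ℂ (Fin (n + 1))) (hx : x ≠ 0) (hy : y ≠ 0)
    (hu : PolySys.uParam f x y ≤ ENNReal.ofReal (ε / 5))
    (hv : PolySys.vParam f g x ≤ ENNReal.ofReal (ε / 5))
    (hrank : PolySys.rankPerp f x = n) :
    PolySys.rankPerp g y = n ∧
      ENNReal.ofReal (1 - ε) * PolySys.condNumber g y ≤ PolySys.condNumber f x ∧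
      PolySys.condNumber f x ≤ ENNReal.ofReal (1 + ε) * PolySys.condNumber g y := by
  open PolySys in
  obtain ⟨m, hm, hmf, hmb, hmin⟩ := exists_condNumber_eq hd hf hx hrank
  obtain ⟨a, b, ha, hb, hax, hby, hab⟩ := exists_smul_inner_eq hx hy
  set c : ℝ := ‖⟪x, y⟫_ℂ‖ / (‖x‖ * ‖y‖) with hc_def
  set θ := distR x y with hθ_def
  set s := sysNorm (normalize f - normalize g) with hs_def
  have hc : 0 ≤ c := by positivity
  have hc1 : c ≤ 1 := div_le_one_of_le₀ (norm_inner_le_norm x y) (by positivity)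
  have hθ0 : 0 ≤ θ := Real.arccos_nonneg _
  have hs0 : 0 ≤ s := sysNorm_nonneg _
  have hθ : 1 - c ≤ θ ^ 2 / 2 := by
    have h := Real.one_sub_sq_div_two_le_cos (x := θ)
    have h' : Real.cos θ = c := Real.cos_arccos (by linarith) hc1
    linarith
  have hs_symm : sysNorm (normalize g - normalize f) = s := by
    rw [← neg_sub, ← neg_one_smul ℂ, sysNorm_smul]; simp [hs_def]
  have hba : ⟪b • y, a • x⟫_ℂ = c := by rw [← inner_conj_symm, hab]; simp
  have hD' : (2 : ℝ) ≤ maxDeg d := by exact_mod_cast hD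
  have hη : m * (s + maxDeg d * θ) ≤ ε / 2 := by
    have hD0 : (0 : ℝ) < maxDeg d := by linarith
    rw [vParam, hmf, ← ENNReal.ofReal_mul (by positivity), ← ENNReal.ofReal_mul (by positivity),
      ENNReal.ofReal_le_ofReal_iff (by positivity), ← Real.sqrt_eq_rpow] at hv
    rw [uParam, hmf, ← ENNReal.ofReal_mul (by positivity), ← ENNReal.ofReal_mul (by positivity),
      ← ENNReal.ofReal_ofNat 2, ← ENNReal.ofReal_div_of_pos (by norm_num),
      ENNReal.ofReal_le_ofReal_iff (by positivity), show (3 / 2 : ℝ) = 1 + 1 / 2 by norm_num,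
      Real.rpow_add hD0, Real.rpow_one, ← Real.sqrt_eq_rpow] at hu
    -- As `D ≥ 2`, the powers of `D` in `u` and `v` exceed those needed by a factor `√D ≥ 7 / 5`.
    have hr : (7 / 5 : ℝ) ≤ √(maxDeg d) := Real.le_sqrt_of_sq_le (by norm_num; linarith)
    have h1 : 7 / 5 * (m * s) ≤ √(maxDeg d) * (m * s) := by gcongr
    have h2 : 7 / 5 * (m * (maxDeg d * θ)) ≤ √(maxDeg d) * (m * (maxDeg d * θ)) := by gcongr
    linarith
  have hmb' := (isCondBound_smul_iff hd ha).2 hmb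
  have hgb := (isCondBound_smul_iff hd hb).1
    (hmb'.perturb hd (sysNorm_normalize hg) hax hby hab hc hθ0 hθ hm (by linarith))
  have hgr : rankPerp g y = n := by
    rw [← mul_div_cancel₀ (m / _) (sysNorm_pos hg).ne', isCondBound_normalize_iff hg] at hgb
    exact hgb.rankPerp_eq hy
  obtain ⟨m', hm', hmg, hmb2, hmin2⟩ := exists_condNumber_eq hd hg hy hgr
  refine ⟨hgr, ?_, ?_⟩
  · rw [hmf, hmg, ← ENNReal.ofReal_mul (by linarith)]
    refine ENNReal.ofReal_le_ofReal ?_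
    have h1 := hmin2 _ (div_nonneg hm (by linarith)) hgb
    rw [le_div_iff₀ (by linarith)] at h1
    have h2 : m' * (1 - ε) ≤ m' * (1 - m * (s + maxDeg d * θ)) := by gcongr; linarith
    linarith
  · rw [hmf, hmg, ← ENNReal.ofReal_mul (by linarith)]
    refine ENNReal.ofReal_le_ofReal ?_
    have h3 : m' * (m * (s + maxDeg d * θ)) ≤ m' * (ε / 2) := by gcongr
    have h4 : 0 ≤ m' * ε := by positivity
    -- The bound for `g` may be too large to perturb back; then `m ≤ m' * (m * (s + D * θ))` is enough.
    rcases lt_or_ge (m' * (s + maxDeg d * θ)) 1 with h | h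
    · have hfb := (isCondBound_smul_iff hd ha).1
        (((isCondBound_smul_iff hd hb).2 hmb2).perturb hd (sysNorm_normalize hf) hby hax hba hc hθ0
          hθ hm' (by rwa [hs_symm]))
      rw [hs_symm] at hfb
      have h1 := hmin _ (div_nonneg hm' (by linarith)) hfb
      rw [le_div_iff₀ (by linarith)] at h1
      linarith
    · have h1 : m * 1 ≤ m * (m' * (s + maxDeg d * θ)) := by gcongr
      linarith
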